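/- Let $H$ be a reproducing kernel Hilbert space of real functions on $\mathbb R^{d}$ with continuous kernel $c$, and let the unknown $f\in H$ satisfy $\|f\|_{H}\le\zeta<\infty$ and be continuously differentiable with $L_g$-Lipschitz gradient. For data $(\xi_j,z_j)_{j\le l}$ and $\sigma>0$ the Gaussian process (posterior) mean is $m(x)=\bar c(x)^\top(\bar C+\sigma^2 I)^{-1}\bar z$, where $\bar C_{ij}=c(\xi_i,\xi_j)$, $\bar c(x)_i=c(x,\xi_i)$ and $\bar z=(z_j)_j$. For $\kappa=(\kappa_{ef},\kappa_{eg},\nu_1^m)$, a function $m$ is a $\kappa$ fully-linear model of $f$ on $B(x;\Delta)$ if $m\in C^1(\mathbb R^d)$, $\nabla m$ is $\nu_1^m$-Lipschitz, and for all $\|s\|\le\Delta$ $$|f(x+s)-m(x+s)|\le\kappa_{ef}\Delta^2,\qquad \|\nabla f(x+s)-\nabla m(x+s)\|\le\kappa_{eg}\Delta .$$ Consider one iteration of a trust-region method on a standard Borel probability space, and let $\mathcal F$ be the $\sigma$-algebra of the events before this iteration. The iterate $x$, the radius $\Delta$, the finite set of data collected so far, and a sequence of new sampling sites $y_1,y_2,\dots$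 are $\mathcal F$-measurable, and almost surely every open set that meets $B(x;\Delta)$ contains $y_i$ for infinitely many $i$. The new observations are $f(y_i)+\nu_i$ with independent $\nu_i\sim\mathcal N(0,\sigma^2)$, jointly independent of $\mathcal F$. Let $m_n$ be the Gaussian process mean computed from the earlier data and the first $n$ new observations. Let $\kappa_{ef}>0$, $\gamma_{lh}>0$, $\nu_1^m\ge L_g+\gamma_{lh}$, $\kappa_{eg},\kappa_{bhh}\in\mathbb R$, $\alpha\in(0,1)$ and $p>\alpha$. Assume that almost surely, for all sufficiently large $n$, the following holds with conditional probability at least $p$ given $\mathcal F$: the mismatch $h_n=f-m_n$ is continuously differentiable on $\mathbb R^d$ with $\gamma_{lh}$-Lipschitz gradient, is twice differentiable at $x$, and $\|\nabla^2h_n(x)\|\le\kappa_{bhh}$. (The case $p=1$ is that in which this holds almost surely.) If almost surely $$0<\Delta<\frac{6}{\gamma_{lh}}\left(\kappa_{eg}-2\kappa_{ef}-\kappa_{bhh}\right),$$ then almost surely there is a positive integer $N<\infty$ such that for every $n\ge N$ $$\mathbb P\left(m_n\text{ is a }\kappa\text{ fully-linear model of }f\text{ on }B(x;\Delta)\,\middle|\,\mathcal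 F\right)\ \ge\ \alpha .$$ -/

import Mathlib

open MeasureTheory ProbabilityTheory Filter Set
open scoped NNReal ENNReal Topology Gradient Matrix

namespace GPTrust

noncomputable section

/-- The scalar kernel `c(x, y)` of a real reproducing kernel Hilbert space `H` of real functions
on a set `X`, so that `⟪f, c(·, y)⟫ = f y` for `f` in `H`. -/
def scalarKernel {X : Type*} (H : Type*) [NormedAddCommGroup H] [InnerProductSpace ℝ H]
    [CompleteSpace H] [RKHS ℝ H X ℝ] (x y : X) : ℝ :=
  RKHS.kernel H x y 1

/-- The posterior mean of Gaussian process regression with prior covariance `c`, noise standard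
deviation `σ`, inputs `ξ` and outputs `z`:
`x ↦ c̄(x)ᵀ (C̄ + σ² I)⁻¹ z` with `C̄ i j = c (ξ i) (ξ j)` and `c̄(x) i = c x (ξ i)`. -/
def gpMean {X : Type*} (c : X → X → ℝ) (σ : ℝ) {l : ℕ} (ξ : Fin l → X) (z : Fin l → ℝ) (x : X) :
    ℝ :=
  (fun i => c x (ξ i)) ⬝ᵥ
    (((Matrix.of fun i j => c (ξ i) (ξ j)) + σ ^ 2 • (1 : Matrix (Fin l) (Fin l) ℝ))⁻¹ *ᵥ z)

/-- The posterior mean computed from `L` earlier data points `(ξ j, z j)` together with `n` new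
noisy evaluations `f (y i) + ν i` of `f` at the sites `y 0, …, y (n - 1)`. -/
def sampledMean {X : Type*} (c : X → X → ℝ) (σ : ℝ) (f : X → ℝ) (L : ℕ) (ξ : ℕ → X) (z : ℕ → ℝ)
    (y : ℕ → X) (ν : ℕ → ℝ) (n : ℕ) : X → ℝ :=
  gpMean c σ (Fin.append (fun j : Fin L => ξ j) (fun i : Fin n => y i))
    (Fin.append (fun j : Fin L => z j) (fun i : Fin n => f (y i) + ν i))

/-- `g` is continuously differentiable on the whole space and its gradient is Lipschitz with
constant `K`. -/
def IsLC1 {d : ℕ} (K : ℝ≥0) (g : EuclideanSpace ℝ (Fin d) → ℝ) : Prop :=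
  ContDiff ℝ 1 g ∧ LipschitzWith K (∇ g)

/-- `m` is a `(κef, κeg, κν)` fully-linear model of `f` on the ball `B(x; Δ)`. -/
def IsFullyLinear {d : ℕ} (κef κeg : ℝ) (κν : ℝ≥0) (f m : EuclideanSpace ℝ (Fin d) → ℝ)
    (x : EuclideanSpace ℝ (Fin d)) (Δ : ℝ) : Prop :=
  IsLC1 κν m ∧
    ∀ s ∈ Metric.closedBall (0 : EuclideanSpace ℝ (Fin d)) Δ,
      |f (x + s) - m (x + s)| ≤ κef * Δ ^ 2 ∧ ‖∇ f (x + s) - ∇ m (x + s)‖ ≤ κeg * Δ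

/-- The mismatch `f - m` has a Lipschitz gradient with constant `γ`, and at the iterate `x` it has
a Hessian (the derivative of the gradient) of operator norm at most `κbh`. -/
def IsRegularMismatch {d : ℕ} (γ : ℝ≥0) (κbh : ℝ) (f m : EuclideanSpace ℝ (Fin d) → ℝ)
    (x : EuclideanSpace ℝ (Fin d)) : Prop :=
  IsLC1 γ (f - m) ∧ DifferentiableAt ℝ (∇ (f - m)) x ∧ ‖fderiv ℝ (∇ (f - m)) x‖ ≤ κbh

/-- The sites `y` fill the ball `B(x; Δ)`: every open set that meets it is visited infinitely
often. Sites outside the ball are allowed. -/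
def FillsBall {d : ℕ} (y : ℕ → EuclideanSpace ℝ (Fin d)) (x : EuclideanSpace ℝ (Fin d)) (Δ : ℝ) :
    Prop :=
  ∀ U : Set (EuclideanSpace ℝ (Fin d)), IsOpen U → (U ∩ Metric.ball x Δ).Nonempty →
    {i | y i ∈ U}.Infinite

end

end GPTrust

/-!
By the reproducing property, the mismatch `f u - m u` is the pairing of `f` with a residual, minus
a weighted sum of the errors in the data. The weights of the posterior mean minimise a ridge cost,
the posterior variance, which dominates both the squared norm of the residual and `σ²` times the
sum of the squared weights. Comparing with uniform weights on many samples close to `u` shows that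
this cost tends to `0` at every point approached infinitely often. The mismatch is therefore a
vanishing bias minus a weighted sum of the noise whose weights vanish in `ℓ²`, and Chebyshev's
inequality gives consistency in probability at each point of the ball.

Pointwise consistency suffices: a function with a Lipschitz gradient that is small on a fine finite
net of a ball is small together with its gradient on the whole ball. Finally, conditioning on the
history freezes the data and keeps the noise orthogonal, so that the argument applies to the
conditional probabilities.
-/

namespace GPTrust

section LipschitzGradient

variable {E : Type*} [NormedAddCommGroup E] [InnerProductSpace ℝ E] [CompleteSpace E]
  {g h : E → ℝ} {K : ℝ≥0}

theorem gradient_sub (hg : Differentiable ℝ g) (hh : Differentiable ℝ h) :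
    ∇ (g - h) = ∇ g - ∇ h := by
  funext u
  simp only [gradient, fderiv_sub (hg u) (hh u), map_sub, Pi.sub_apply]

theorem abs_sub_sub_inner_gradient_le (hh : Differentiable ℝ h) (hK : LipschitzWith K (∇ h))
    (u v : E) : |h v - h u - inner ℝ (∇ h u) (v - u)| ≤ K * ‖v - u‖ ^ 2 := by
  have hfderiv : ∀ w ∈ Metric.closedBall u ‖v - u‖,
      ‖fderiv ℝ h w - fderiv ℝ h u‖ ≤ K * ‖v - u‖ := fun w hw => by
    rw [← toDual_gradient, ← toDual_gradient, ← map_sub, LinearIsometryEquiv.norm_map]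
    refine (hK.norm_sub_le w u).trans ?_
    gcongr
    exact mem_closedBall_iff_norm.1 hw
  have htaylor := (convex_closedBall u ‖v - u‖).norm_image_sub_le_of_norm_fderiv_le'
    (fun w _ => hh w) hfderiv (Metric.mem_closedBall_self (norm_nonneg _))
    (mem_closedBall_iff_norm.2 le_rfl)
  rwa [inner_gradient_left, ← Real.norm_eq_abs, pow_two, ← mul_assoc]

theorem norm_gradient_le_of_exists_near_sphere (hh : Differentiable ℝ h)
    (hK : LipschitzWith K (∇ h)) {v : E} {r : ℝ} (hr : 0 < r) (hv : |h v| ≤ r ^ 2)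
    (hnear : ∀ w, dist w v = 2 * r → ∃ s, dist s w ≤ r ∧ |h s| ≤ r ^ 2) :
    ‖∇ h v‖ ≤ (2 + 9 * K) * r := by
  obtain hG | hG := eq_or_ne (∇ h v) 0
  · rw [hG, norm_zero]
    positivity
  set t : E := (2 * r / ‖∇ h v‖) • ∇ h v with ht
  have hnorm_t : ‖t‖ = 2 * r := by
    rw [ht, norm_smul, Real.norm_of_nonneg (by positivity),
      div_mul_cancel₀ _ (norm_ne_zero_iff.2 hG)]
  obtain ⟨s, hsw, hs⟩ := hnear (v + t) (by rw [dist_self_add_left, hnorm_t])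
  rw [dist_eq_norm] at hsw
  have hsv : ‖s - v‖ ≤ 3 * r := by
    have := norm_add_le (s - (v + t)) t
    rw [sub_add_eq_sub_sub, sub_add_cancel] at this
    rw [sub_add_eq_sub_sub] at hsw
    linarith
  have hlower : ‖∇ h v‖ * r ≤ inner ℝ (∇ h v) (s - v) := by
    have hinner_t : inner ℝ (∇ h v) t = ‖∇ h v‖ * (2 * r) := by
      rw [ht, real_inner_smul_right, real_inner_self_eq_norm_sq]
      field_simp
    have hinner_s : -(‖∇ h v‖ * r) ≤ inner ℝ (∇ h v) (s - (v + t)) :=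
      (neg_le_neg (mul_le_mul_of_nonneg_left hsw (norm_nonneg _))).trans
        (neg_le_of_abs_le (abs_real_inner_le_norm _ _))
    have hsplit : s - v = t + (s - (v + t)) := by abel
    rw [hsplit, inner_add_right, hinner_t]
    linarith
  have hupper : inner ℝ (∇ h v) (s - v) ≤ 2 * r ^ 2 + K * (3 * r) ^ 2 := by
    have htaylor := (abs_le.1 (abs_sub_sub_inner_gradient_le hh hK v s)).1
    have hsq : (K : ℝ) * ‖s - v‖ ^ 2 ≤ K * (3 * r) ^ 2 := by gcongr
    linarith [(abs_le.1 hs).2, (abs_le.1 hv).1]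
  refine le_of_mul_le_mul_right ?_ hr
  linarith

theorem abs_le_and_norm_gradient_le_of_ball_subset_biUnion (hh : Differentiable ℝ h)
    (hK : LipschitzWith K (∇ h)) {S : Set E} {x : E} {Δ r : ℝ} (hr : 0 < r) (hrΔ : 3 * r ≤ Δ)
    (hS : Metric.ball x Δ ⊆ ⋃ s ∈ S, Metric.ball s r) (hsmall : ∀ s ∈ S, |h s| ≤ r ^ 2)
    {u : E} (hu : u ∈ Metric.closedBall x Δ) :
    |h u| ≤ (9 + 52 * K) * r ^ 2 ∧ ‖∇ h u‖ ≤ (2 + 13 * K) * r := by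
  have hcover : ∀ w ∈ Metric.ball x Δ, ∃ s ∈ S, dist w s < r := fun w hw => by
    simpa only [mem_iUnion₂, Metric.mem_ball, exists_prop] using hS hw
  -- Move towards the center, so that a sphere around the chosen site stays inside the ball.
  obtain ⟨u', huu', hu'x⟩ := exists_dist_le_le (δ := 3 * r) (ε := Δ - 3 * r) (by positivity)
    (sub_nonneg.2 hrΔ) (by simpa using hu)
  obtain ⟨v, hvS, hu'v⟩ := hcover u' (Metric.mem_ball.2 (by linarith))
  have hgrad : ‖∇ h v‖ ≤ (2 + 9 * K) * r := by
    refine norm_gradient_le_of_exists_near_sphere hh hK hr (hsmall v hvS) fun w hwv => ?_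
    have hwx : dist w x < Δ := by
      linarith [dist_triangle4 w v u' x, dist_comm v u']
    obtain ⟨s, hsS, hws⟩ := hcover w hwx
    exact ⟨s, dist_comm w s ▸ hws.le, hsmall s hsS⟩
  have huv : ‖u - v‖ ≤ 4 * r := by
    rw [← dist_eq_norm]
    linarith [dist_triangle u u' v]
  constructor
  · have htaylor := abs_sub_sub_inner_gradient_le hh hK v u
    have hinner : |inner ℝ (∇ h v) (u - v)| ≤ (2 + 9 * K) * r * (4 * r) :=
      (abs_real_inner_le_norm _ _).trans (by gcongr)
    calc |h u| = |h v + inner ℝ (∇ h v) (u - v) + (h u - h v - inner ℝ (∇ h v) (u - v))| := by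
          congr 1; ring
      _ ≤ |h v| + |inner ℝ (∇ h v) (u - v)| + |h u - h v - inner ℝ (∇ h v) (u - v)| :=
          abs_add_three _ _ _
      _ ≤ r ^ 2 + (2 + 9 * K) * r * (4 * r) + K * (4 * r) ^ 2 := by
          gcongr
          · exact hsmall v hvS
          · exact htaylor.trans (by gcongr)
      _ = (9 + 52 * K) * r ^ 2 := by ring
  · calc ‖∇ h u‖ ≤ ‖∇ h v‖ + ‖∇ h u - ∇ h v‖ := norm_le_norm_add_norm_sub' _ _
      _ ≤ (2 + 9 * K) * r + K * (4 * r) := by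
          gcongr
          exact (hK.norm_sub_le u v).trans (by gcongr)
      _ = (2 + 13 * K) * r := by ring

theorem exists_finset_abs_le_and_norm_gradient_le [ProperSpace E] (K : ℝ≥0) (x : E) {Δ a b : ℝ}
    (hΔ : 0 < Δ) (ha : 0 < a) (hb : 0 < b) :
    ∃ S : Finset E, ↑S ⊆ Metric.ball x Δ ∧ ∃ ε > 0, ∀ h : E → ℝ, Differentiable ℝ h →
      LipschitzWith K (∇ h) → (∀ s ∈ S, |h s| ≤ ε) →
        ∀ u ∈ Metric.closedBall x Δ, |h u| ≤ a ∧ ‖∇ h u‖ ≤ b := by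
  have hlt : ∀ {φ : ℝ → ℝ} {c : ℝ}, Continuous φ → φ 0 = 0 → 0 < c → ∀ᶠ r in 𝓝[>] 0, φ r < c :=
    fun hφ hφ0 hc =>
      ((hφ.tendsto' 0 0 hφ0).eventually_lt_const hc).filter_mono nhdsWithin_le_nhds
  obtain ⟨r, hrΔ, hra, hrb, hr⟩ := ((hlt (φ := fun r => 3 * r) (by fun_prop) (by simp) hΔ).and <|
    (hlt (φ := fun r => (9 + 52 * K) * r ^ 2) (by fun_prop) (by simp) ha).and <|
    (hlt (φ := fun r => (2 + 13 * K) * r) (by fun_prop) (by simp) hb).and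
    self_mem_nhdsWithin).exists
  obtain ⟨S, hSball, hSfin, hS⟩ := exists_finite_cover_balls_of_isCompact_closure
    (Metric.isBounded_ball (x := x) (r := Δ)).isCompact_closure hr
  lift S to Finset E using hSfin
  refine ⟨S, hSball, r ^ 2, pow_pos hr 2, fun h hh hK hsmall u hu => ?_⟩
  obtain ⟨hval, hgrad⟩ :=
    abs_le_and_norm_gradient_le_of_ball_subset_biUnion hh hK hr hrΔ.le hS hsmall hu
  exact ⟨hval.trans hra.le, hgrad.trans hrb.le⟩

end LipschitzGradient

section FullyLinear

variable {d : ℕ} {f m : EuclideanSpace ℝ (Fin d) → ℝ} {x : EuclideanSpace ℝ (Fin d)}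
  {K K' Lg κν γ : ℝ≥0} {κef κeg κbh Δ : ℝ}

theorem IsLC1.differentiable (hf : IsLC1 K f) : Differentiable ℝ f :=
  hf.1.differentiable one_ne_zero

theorem IsLC1.sub (hf : IsLC1 K f) (hm : IsLC1 K' m) : IsLC1 (K + K') (f - m) := by
  refine ⟨hf.1.sub hm.1, ?_⟩
  rw [gradient_sub hf.differentiable hm.differentiable]
  exact hf.2.sub hm.2

theorem IsLC1.mono (hf : IsLC1 K f) (hK : K ≤ K') : IsLC1 K' f :=
  ⟨hf.1, hf.2.weaken hK⟩

theorem exists_finset_isFullyLinear (hf : IsLC1 Lg f) (hκν : Lg + γ ≤ κν) (hκef : 0 < κef)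
    (hκeg : 0 < κeg) (x : EuclideanSpace ℝ (Fin d)) (hΔ : 0 < Δ) :
    ∃ S : Finset (EuclideanSpace ℝ (Fin d)), ↑S ⊆ Metric.ball x Δ ∧ ∃ ε > 0,
      ∀ m, IsLC1 γ (f - m) → (∀ u ∈ S, |f u - m u| ≤ ε) → IsFullyLinear κef κeg κν f m x Δ := by
  obtain ⟨S, hS, ε, hε, hsmall⟩ := exists_finset_abs_le_and_norm_gradient_le γ x hΔ
    (mul_pos hκef (pow_pos hΔ 2)) (mul_pos hκeg hΔ)
  refine ⟨S, hS, ε, hε, fun m hfm hmS => ?_⟩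
  have hm : IsLC1 (Lg + γ) m := by simpa only [sub_sub_cancel] using hf.sub hfm
  refine ⟨hm.mono hκν, fun s hs => ?_⟩
  have hball : x + s ∈ Metric.closedBall x Δ := by simpa [dist_eq_norm] using hs
  simpa only [gradient_sub hf.differentiable hm.differentiable, Pi.sub_apply] using
    hsmall _ hfm.differentiable hfm.2 hmS (x + s) hball

theorem IsRegularMismatch.gradientConst_pos (hm : IsRegularMismatch γ κbh f m x) (hκef : 0 ≤ κef)
    (hΔ : 0 < Δ) (hΔ' : Δ < 6 / γ * (κeg - 2 * κef - κbh)) : 0 < κeg := by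
  have hκbh : 0 ≤ κbh := (norm_nonneg _).trans hm.2.2
  have hκ : 0 < κeg - 2 * κef - κbh := pos_of_mul_pos_right (hΔ.trans hΔ') (by positivity)
  linarith

end FullyLinear

section RidgeRegression

variable {ι V : Type*} [Fintype ι] [NormedAddCommGroup V] [InnerProductSpace ℝ V] {lam η : ℝ}
  {φ : V} {ψ : ι → V} {w : ι → ℝ}

/-- The penalised squared error of approximating `φ` by the linear combination of the `ψ i` with
weights `w`. For the features of a kernel and `lam` the noise variance, its minimum over `w` is the
posterior variance. -/
def ridgeCost (lam : ℝ) (φ : V) (ψ : ι → V) (w : ι → ℝ) : ℝ :=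
  ‖φ - ∑ i, w i • ψ i‖ ^ 2 + lam * ∑ i, w i ^ 2

theorem norm_sq_le_ridgeCost (hlam : 0 ≤ lam) :
    ‖φ - ∑ i, w i • ψ i‖ ^ 2 ≤ ridgeCost lam φ ψ w :=
  le_add_of_nonneg_right (mul_nonneg hlam (Finset.sum_nonneg fun _ _ => sq_nonneg _))

theorem mul_sum_sq_le_ridgeCost : lam * ∑ i, w i ^ 2 ≤ ridgeCost lam φ ψ w :=
  le_add_of_nonneg_left (sq_nonneg _)

theorem ridgeCost_nonneg (hlam : 0 ≤ lam) : 0 ≤ ridgeCost lam φ ψ w :=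
  (sq_nonneg _).trans (norm_sq_le_ridgeCost hlam)

theorem ridgeCost_le_of_normal_equations (hlam : 0 ≤ lam)
    (hw : ∀ i, inner ℝ (φ - ∑ j, w j • ψ j) (ψ i) = lam * w i) (v : ι → ℝ) :
    ridgeCost lam φ ψ w ≤ ridgeCost lam φ ψ v := by
  set r : V := φ - ∑ i, w i • ψ i with hr
  set s : V := ∑ i, (v i - w i) • ψ i with hs
  have hrs : φ - ∑ i, v i • ψ i = r - s := by
    simp only [hr, hs, sub_smul, Finset.sum_sub_distrib]
    abel
  have hinner : inner ℝ r s = lam * ∑ i, (v i - w i) * w i := by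
    simp only [hs, inner_sum, real_inner_smul_right, hw, Finset.mul_sum]
    exact Finset.sum_congr rfl fun _ _ => by ring
  have hsq : ∑ i, v i ^ 2 =
      ∑ i, w i ^ 2 + 2 * ∑ i, (v i - w i) * w i + ∑ i, (v i - w i) ^ 2 := by
    simp only [Finset.mul_sum, ← Finset.sum_add_distrib]
    exact Finset.sum_congr rfl fun _ _ => by ring
  calc ridgeCost lam φ ψ w
      ≤ ridgeCost lam φ ψ w + (‖s‖ ^ 2 + lam * ∑ i, (v i - w i) ^ 2) :=
        le_add_of_nonneg_right (add_nonneg (sq_nonneg _)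
          (mul_nonneg hlam (Finset.sum_nonneg fun _ _ => sq_nonneg _)))
    _ = ridgeCost lam φ ψ v := by
        rw [ridgeCost, ridgeCost, hrs, ← hr, norm_sub_sq_real r s, hinner, hsq]
        ring

theorem exists_ridgeCost_le_add_div_card {T : Finset ι} (hT : T.Nonempty)
    (hη : ∀ i ∈ T, ‖φ - ψ i‖ ≤ η) :
    ∃ w : ι → ℝ, ridgeCost lam φ ψ w ≤ η ^ 2 + lam / T.card := by
  classical
  have hcard : (T.card : ℝ) ≠ 0 := Nat.cast_ne_zero.2 hT.card_pos.ne'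
  refine ⟨fun i => if i ∈ T then (T.card : ℝ)⁻¹ else 0, add_le_add ?_ (le_of_eq ?_)⟩
  · have hmean : ∑ i ∈ T, (T.card : ℝ)⁻¹ • ψ i ∈ Metric.closedBall φ η :=
      (convex_closedBall φ η).sum_mem (fun _ _ => by positivity)
        (by rw [Finset.sum_const, nsmul_eq_mul, mul_inv_cancel₀ hcard])
        fun i hi => mem_closedBall_iff_norm'.2 (hη i hi)
    simp only [ite_smul, zero_smul, Finset.sum_ite_mem, Finset.univ_inter]
    gcongr
    exact mem_closedBall_iff_norm'.1 hmean
  · simp only [ite_pow, ne_eq, OfNat.ofNat_ne_zero, not_false_eq_true, zero_pow,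
      Finset.sum_ite_mem, Finset.univ_inter, Finset.sum_const, nsmul_eq_mul]
    field_simp

end RidgeRegression

section Posterior

variable {X H : Type*} [NormedAddCommGroup H] [InnerProductSpace ℝ H] [CompleteSpace H]
  [RKHS ℝ H X ℝ]

variable (H) in
/-- The function `c(·, u)` of the kernel `c`, as an element of the reproducing kernel Hilbert
space: the representer of evaluation at `u`. -/
noncomputable def feature (u : X) : H :=
  RKHS.kerFun H u 1

theorem inner_feature_left (u : X) (f : H) : inner ℝ (feature H u) f = f u := by
  rw [feature, RKHS.kerFun_inner]
  exact mul_one (f u)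

theorem scalarKernel_eq_inner (u v : X) :
    scalarKernel H u v = inner ℝ (feature H u) (feature H v) := by
  rw [inner_feature_left, feature, RKHS.kerFun_apply, scalarKernel]

theorem continuous_feature [TopologicalSpace X]
    (hc : Continuous fun q : X × X => scalarKernel H q.1 q.2) :
    Continuous (feature H (X := X)) := by
  refine continuous_iff_continuousAt.2 fun u => tendsto_iff_norm_sub_tendsto_zero.2 ?_
  have hnorm : ∀ v, ‖feature H v - feature H u‖ =
      √(scalarKernel H v v - 2 * scalarKernel H v u + scalarKernel H u u) := fun v => by
    simp only [scalarKernel_eq_inner, real_inner_self_eq_norm_sq, ← norm_sub_sq_real,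
      Real.sqrt_sq (norm_nonneg _)]
  refine Continuous.tendsto' ?_ u 0 (by rw [sub_self, norm_zero])
  simp only [hnorm]
  generalize scalarKernel H = c at hc
  fun_prop

variable {l : ℕ} {σ : ℝ} {ξ : Fin l → X}

/-- The matrix `C̄ + σ² I` of the regression formula, the covariance of the noisy outputs. -/
noncomputable def noisyGram (c : X → X → ℝ) (σ : ℝ) (ξ : Fin l → X) : Matrix (Fin l) (Fin l) ℝ :=
  (Matrix.of fun i j => c (ξ i) (ξ j)) + σ ^ 2 • 1

/-- The weights `(C̄ + σ² I)⁻¹ c̄(u)` that the posterior mean at `u` gives to the outputs. -/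
noncomputable def gpWeights (c : X → X → ℝ) (σ : ℝ) (ξ : Fin l → X) (u : X) : Fin l → ℝ :=
  (noisyGram c σ ξ)⁻¹ *ᵥ fun i => c u (ξ i)

theorem posDef_noisyGram (hσ : σ ≠ 0) (ξ : Fin l → X) :
    (noisyGram (scalarKernel H) σ ξ).PosDef := by
  have hgram : (Matrix.of fun i j => scalarKernel H (ξ i) (ξ j)) =
      Matrix.gram ℝ fun i => feature H (ξ i) := by
    ext i j
    rw [Matrix.of_apply, scalarKernel_eq_inner, Matrix.gram_apply]
  rw [noisyGram, hgram]
  exact .posSemidef_add (Matrix.posSemidef_gram ℝ _) (Matrix.PosDef.one.smul (by positivity))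

theorem gpMean_eq_sum (hσ : σ ≠ 0) (ξ : Fin l → X) (z : Fin l → ℝ) (u : X) :
    gpMean (scalarKernel H) σ ξ z u = ∑ i, gpWeights (scalarKernel H) σ ξ u i * z i := by
  have hsymm : (noisyGram (scalarKernel H) σ ξ)ᵀ = noisyGram (scalarKernel H) σ ξ := by
    simpa only [Matrix.conjTranspose_eq_transpose_of_trivial] using
      (posDef_noisyGram (H := H) hσ ξ).isHermitian.eq
  rw [gpMean, ← noisyGram, Matrix.dotProduct_mulVec, ← Matrix.mulVec_transpose,
    Matrix.transpose_nonsing_inv, hsymm]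
  rfl

variable (H) in
/-- The representer of the error at `u` of the posterior mean for exact outputs. -/
noncomputable def posteriorResidual (σ : ℝ) (ξ : Fin l → X) (u : X) : H :=
  feature H u - ∑ i, gpWeights (scalarKernel H) σ ξ u i • feature H (ξ i)

theorem sub_gpMean_eq (hσ : σ ≠ 0) (ξ : Fin l → X) (z : Fin l → ℝ) (u : X) (f : H) :
    f u - gpMean (scalarKernel H) σ ξ z u = inner ℝ (posteriorResidual H σ ξ u) f -
      ∑ i, gpWeights (scalarKernel H) σ ξ u i * (z i - f (ξ i)) := by
  simp only [gpMean_eq_sum hσ, posteriorResidual, inner_sub_left, sum_inner, real_inner_smul_left,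
    inner_feature_left, mul_sub, Finset.sum_sub_distrib]
  ring

theorem inner_posteriorResidual_feature (hσ : σ ≠ 0) (ξ : Fin l → X) (u : X) (i : Fin l) :
    inner ℝ (posteriorResidual H σ ξ u) (feature H (ξ i)) =
      σ ^ 2 * gpWeights (scalarKernel H) σ ξ u i := by
  have hsolve : noisyGram (scalarKernel H) σ ξ *ᵥ gpWeights (scalarKernel H) σ ξ u =
      fun i => scalarKernel H u (ξ i) := by
    rw [gpWeights, Matrix.mulVec_mulVec, Matrix.mul_nonsing_inv _
      ((Matrix.isUnit_iff_isUnit_det _).1 (posDef_noisyGram hσ ξ).isUnit), Matrix.one_mulVec]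
  have hgram : ((Matrix.of fun i j => scalarKernel H (ξ i) (ξ j)) *ᵥ
      gpWeights (scalarKernel H) σ ξ u) i =
        inner ℝ (∑ j, gpWeights (scalarKernel H) σ ξ u j • feature H (ξ j)) (feature H (ξ i)) := by
    simp only [Matrix.mulVec, dotProduct, Matrix.of_apply, sum_inner, real_inner_smul_left,
      scalarKernel_eq_inner]
    exact Finset.sum_congr rfl fun j _ => by rw [real_inner_comm, mul_comm]
  have hrow := congrFun hsolve i
  rw [noisyGram, Matrix.add_mulVec, Matrix.smul_mulVec, Matrix.one_mulVec, Pi.add_apply, hgram,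
    Pi.smul_apply, smul_eq_mul] at hrow
  rw [posteriorResidual, inner_sub_left, ← scalarKernel_eq_inner, ← hrow, add_sub_cancel_left]

variable (H) in
/-- The posterior variance at `u` of Gaussian process regression with inputs `ξ` and noise standard
deviation `σ`, in variational form: the cost of the weights of the posterior mean. -/
noncomputable def posteriorVariance (σ : ℝ) (ξ : Fin l → X) (u : X) : ℝ :=
  ridgeCost (σ ^ 2) (feature H u) (fun i => feature H (ξ i)) (gpWeights (scalarKernel H) σ ξ u)

theorem posteriorVariance_le_ridgeCost (hσ : σ ≠ 0) (ξ : Fin l → X) (u : X) (w : Fin l → ℝ) :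
    posteriorVariance H σ ξ u ≤ ridgeCost (σ ^ 2) (feature H u) (fun i => feature H (ξ i)) w :=
  ridgeCost_le_of_normal_equations (sq_nonneg σ) (inner_posteriorResidual_feature hσ ξ u) w

end Posterior

section Consistency

variable {X H : Type*} [NormedAddCommGroup H] [InnerProductSpace ℝ H] [CompleteSpace H]
  [RKHS ℝ H X ℝ] {σ : ℝ}

/-- The inputs of `sampledMean`: the first `L` of the old sites `ξ`, then the first `n` of the new
sites `y`. -/
def sampledSites (L : ℕ) (ξ y : ℕ → X) (n : ℕ) : Fin (L + n) → X :=
  Fin.append (fun j : Fin L => ξ j) (fun i : Fin n => y i)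

theorem posteriorVariance_sampledSites_le (hσ : σ ≠ 0) (L : ℕ) (ξ : ℕ → X) {y : ℕ → X} {u : X}
    {T : Finset ℕ} (hT : T.Nonempty) {η : ℝ}
    (hη : ∀ i ∈ T, ‖feature H u - feature H (y i)‖ ≤ η) {n : ℕ} (hn : ∀ i ∈ T, i < n) :
    posteriorVariance H σ (sampledSites L ξ y n) u ≤ η ^ 2 + σ ^ 2 / T.card := by
  set T' : Finset (Fin (L + n)) := (T.attachFin hn).map (Fin.natAddEmb L) with hT'
  have hcard : T'.card = T.card := by rw [hT', Finset.card_map, Finset.card_attachFin]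
  have hclose : ∀ i ∈ T', ‖feature H u - feature H (sampledSites L ξ y n i)‖ ≤ η := by
    simp only [hT', Finset.mem_map, Finset.mem_attachFin]
    rintro _ ⟨i, hi, rfl⟩
    simpa only [sampledSites, Fin.natAddEmb_apply, Fin.append_right] using hη i hi
  obtain ⟨w, hw⟩ := exists_ridgeCost_le_add_div_card (lam := σ ^ 2)
    (Finset.card_pos.1 (hcard ▸ hT.card_pos)) hclose
  exact (posteriorVariance_le_ridgeCost hσ _ u w).trans (hcard ▸ hw)

variable [TopologicalSpace X]

theorem tendsto_posteriorVariance_sampledSites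
    (hc : Continuous fun q : X × X => scalarKernel H q.1 q.2) (hσ : σ ≠ 0) (L : ℕ) (ξ : ℕ → X)
    {y : ℕ → X} {u : X} (hu : MapClusterPt u atTop y) :
    Tendsto (fun n => posteriorVariance H σ (sampledSites L ξ y n) u) atTop (𝓝 0) := by
  have hnonneg : ∀ n, 0 ≤ posteriorVariance H σ (sampledSites L ξ y n) u := fun n =>
    ridgeCost_nonneg (sq_nonneg σ)
  refine tendsto_order.2 ⟨fun a ha => .of_forall fun n => ha.trans_le (hnonneg n), fun δ hδ => ?_⟩
  have hη : 0 < √(δ / 2) := by positivity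
  have hvisits : {i | feature H (y i) ∈ Metric.ball (feature H u) √(δ / 2)}.Infinite :=
    Nat.frequently_atTop_iff_infinite.1 (mapClusterPt_iff_frequently.1
      (hu.continuousAt_comp (continuous_feature hc).continuousAt) _ (Metric.ball_mem_nhds _ hη))
  obtain ⟨k, hk⟩ := exists_nat_gt (2 * σ ^ 2 / δ)
  have hk0 : (0 : ℝ) < k := lt_of_le_of_lt (by positivity) hk
  obtain ⟨T, hTball, rfl⟩ := hvisits.exists_subset_card_eq k
  have hclose : ∀ i ∈ T, ‖feature H u - feature H (y i)‖ ≤ √(δ / 2) := fun i hi =>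
    (mem_ball_iff_norm'.1 (hTball hi)).le
  filter_upwards [eventually_gt_atTop (T.sup id)] with n hn
  calc posteriorVariance H σ (sampledSites L ξ y n) u
      ≤ √(δ / 2) ^ 2 + σ ^ 2 / T.card :=
        posteriorVariance_sampledSites_le hσ L ξ (Finset.card_pos.1 (Nat.cast_pos.1 hk0)) hclose
          fun i hi => (Finset.le_sup (f := id) hi).trans_lt hn
    _ < δ / 2 + δ / 2 := by
        rw [Real.sq_sqrt (by positivity)]
        refine add_lt_add_right ?_ _
        rw [div_lt_iff₀ hδ] at hk
        rw [div_lt_iff₀ hk0]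
        linarith
    _ = δ := add_halves δ

theorem tendsto_posteriorResidual_sampledSites
    (hc : Continuous fun q : X × X => scalarKernel H q.1 q.2) (hσ : σ ≠ 0) (L : ℕ) (ξ : ℕ → X)
    {y : ℕ → X} {u : X} (hu : MapClusterPt u atTop y) :
    Tendsto (fun n => posteriorResidual H σ (sampledSites L ξ y n) u) atTop (𝓝 0) := by
  have hsqrt := (tendsto_posteriorVariance_sampledSites hc hσ L ξ hu).sqrt
  rw [Real.sqrt_zero] at hsqrt
  exact squeeze_zero_norm
    (fun n => Real.le_sqrt_of_sq_le (norm_sq_le_ridgeCost (sq_nonneg σ))) hsqrt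

theorem tendsto_sum_sq_gpWeights_sampledSites
    (hc : Continuous fun q : X × X => scalarKernel H q.1 q.2) (hσ : σ ≠ 0) (L : ℕ) (ξ : ℕ → X)
    {y : ℕ → X} {u : X} (hu : MapClusterPt u atTop y) :
    Tendsto (fun n => ∑ i, gpWeights (scalarKernel H) σ (sampledSites L ξ y n) u i ^ 2) atTop
      (𝓝 0) := by
  have hdiv := (tendsto_posteriorVariance_sampledSites hc hσ L ξ hu).div_const (σ ^ 2)
  rw [zero_div] at hdiv
  have hσ2 : 0 < σ ^ 2 := by positivity
  exact squeeze_zero (fun n => Finset.sum_nonneg fun _ _ => sq_nonneg _)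
    (fun n => (le_div_iff₀' hσ2).2 mul_sum_sq_le_ridgeCost) hdiv

theorem exists_tendsto_sub_sampledMean_eq
    (hc : Continuous fun q : X × X => scalarKernel H q.1 q.2) (hσ : σ ≠ 0) (f : H) (L : ℕ)
    (ξ : ℕ → X) (z : ℕ → ℝ) {y : ℕ → X} {u : X} (hu : MapClusterPt u atTop y) :
    ∃ (b : ℕ → ℝ) (w : (n : ℕ) → Fin n → ℝ), Tendsto b atTop (𝓝 0) ∧
      Tendsto (fun n => ∑ i, w n i ^ 2) atTop (𝓝 0) ∧
      ∀ n ν, f u - sampledMean (scalarKernel H) σ f L ξ z y ν n u = b n - ∑ i, w n i * ν i := by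
  set W : (n : ℕ) → Fin (L + n) → ℝ := fun n =>
    gpWeights (scalarKernel H) σ (sampledSites L ξ y n) u
  have hW : Tendsto (fun n => ∑ i, W n i ^ 2) atTop (𝓝 0) :=
    tendsto_sum_sq_gpWeights_sampledSites hc hσ L ξ hu
  have hold : ∀ j : Fin L, Tendsto (fun n => W n (Fin.castAdd n j)) atTop (𝓝 0) := fun j => by
    refine squeeze_zero_norm (fun n => Real.abs_le_sqrt (Finset.single_le_sum
      (f := fun i => W n i ^ 2) (fun _ _ => sq_nonneg _) (Finset.mem_univ (Fin.castAdd n j)))) ?_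
    simpa only [Real.sqrt_zero] using hW.sqrt
  refine ⟨fun n => inner ℝ (posteriorResidual H σ (sampledSites L ξ y n) u) f -
      ∑ j : Fin L, W n (Fin.castAdd n j) * (z j - f (ξ j)),
    fun n i => W n (Fin.natAdd L i), ?_, ?_, fun n ν => ?_⟩
  · simpa only [inner_zero_left, zero_mul, Finset.sum_const_zero, sub_zero] using
      ((tendsto_posteriorResidual_sampledSites hc hσ L ξ hu).inner tendsto_const_nhds).sub
        (tendsto_finsetSum Finset.univ fun j _ => (hold j).mul_const (z j - f (ξ j)))
  · refine squeeze_zero (fun n => Finset.sum_nonneg fun _ _ => sq_nonneg _) (fun n => ?_) hW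
    rw [Fin.sum_univ_add]
    exact le_add_of_nonneg_left (Finset.sum_nonneg fun _ _ => sq_nonneg _)
  · rw [sampledMean, ← sampledSites, sub_gpMean_eq hσ, Fin.sum_univ_add]
    simp only [sampledSites, Fin.append_left, Fin.append_right, add_sub_cancel_left]
    exact sub_add_eq_sub_sub _ _ _

end Consistency

theorem FillsBall.mapClusterPt {d : ℕ} {y : ℕ → EuclideanSpace ℝ (Fin d)}
    {x u : EuclideanSpace ℝ (Fin d)} {Δ : ℝ} (hy : FillsBall y x Δ) (hu : u ∈ Metric.ball x Δ) :
    MapClusterPt u atTop y := by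
  refine mapClusterPt_iff_frequently.2 fun s hs => ?_
  obtain ⟨U, hUs, hU, huU⟩ := mem_nhds_iff.1 hs
  exact (Nat.frequently_atTop_iff_infinite.2 (hy U hU ⟨u, huU, hu⟩)).mono fun i hi => hUs hi

section Noise

variable {ι Ω : Type*} {mΩ : MeasurableSpace Ω} {P : Measure Ω} {ν : ι → Ω → ℝ} {v : ℝ}

/-- The variables `ν i` are orthogonal in `L²(P)` with common second moment `v`. Unlike
independence, this property of a centred noise is read off its second moments alone, and so
it is inherited by conditional probabilities. -/
structure IsOrthogonalNoise (ν : ι → Ω → ℝ) (v : ℝ) (P : Measure Ω) : Prop where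
  integrable_mul : ∀ i j, Integrable (fun ω => ν i ω * ν j ω) P
  integral_mul_self : ∀ i, ∫ ω, ν i ω * ν i ω ∂P = v
  integral_mul_eq_zero : ∀ i j, i ≠ j → ∫ ω, ν i ω * ν j ω ∂P = 0

theorem IsOrthogonalNoise.comp_injective {κ : Type*} (hν : IsOrthogonalNoise ν v P) {e : κ → ι}
    (he : e.Injective) : IsOrthogonalNoise (fun k => ν (e k)) v P where
  integrable_mul i j := hν.integrable_mul (e i) (e j)
  integral_mul_self i := hν.integral_mul_self (e i)
  integral_mul_eq_zero i j hij := hν.integral_mul_eq_zero (e i) (e j) (he.ne hij)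

theorem sum_mul_sq_eq [Fintype ι] (w a : ι → ℝ) :
    (∑ i, w i * a i) ^ 2 = ∑ i, ∑ j, w i * w j * (a i * a j) := by
  rw [pow_two, Finset.sum_mul_sum]
  exact Finset.sum_congr rfl fun i _ => Finset.sum_congr rfl fun j _ => by ring

theorem IsOrthogonalNoise.integrable_sum_sq [Fintype ι] (hν : IsOrthogonalNoise ν v P)
    (w : ι → ℝ) : Integrable (fun ω => (∑ i, w i * ν i ω) ^ 2) P := by
  simp_rw [sum_mul_sq_eq]
  exact integrable_finsetSum _ fun i _ => integrable_finsetSum _ fun j _ =>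
    (hν.integrable_mul i j).const_mul _

theorem IsOrthogonalNoise.integral_sum_sq [Fintype ι] (hν : IsOrthogonalNoise ν v P) (w : ι → ℝ) :
    ∫ ω, (∑ i, w i * ν i ω) ^ 2 ∂P = v * ∑ i, w i ^ 2 := by
  have hint : ∀ i j, Integrable (fun ω => w i * w j * (ν i ω * ν j ω)) P := fun i j =>
    (hν.integrable_mul i j).const_mul _
  have hrow : ∀ i, ∫ ω, ∑ j, w i * w j * (ν i ω * ν j ω) ∂P = v * w i ^ 2 := fun i => by
    rw [integral_finsetSum _ fun j _ => hint i j, Finset.sum_eq_single i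
      (fun j _ hji => by rw [integral_const_mul, hν.integral_mul_eq_zero i j hji.symm, mul_zero])
      (fun hi => absurd (Finset.mem_univ i) hi), integral_const_mul, hν.integral_mul_self]
    ring
  simp_rw [sum_mul_sq_eq]
  rw [integral_finsetSum _ fun i _ => integrable_finsetSum _ fun j _ => hint i j, Finset.mul_sum]
  exact Finset.sum_congr rfl fun i _ => hrow i

theorem IsOrthogonalNoise.measure_le_abs_sum_le [Fintype ι] [IsFiniteMeasure P]
    (hν : IsOrthogonalNoise ν v P) (w : ι → ℝ) {δ : ℝ} (hδ : 0 < δ) :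
    P {ω | δ ≤ |∑ i, w i * ν i ω|} ≤ ENNReal.ofReal (v * (∑ i, w i ^ 2) / δ ^ 2) := by
  have hmarkov := mul_meas_ge_le_integral_of_nonneg (ae_of_all P fun ω => sq_nonneg _)
    (hν.integrable_sum_sq w) (δ ^ 2)
  rw [hν.integral_sum_sq, ← le_div_iff₀' (by positivity)] at hmarkov
  have hset : {ω | δ ≤ |∑ i, w i * ν i ω|} = {ω | δ ^ 2 ≤ (∑ i, w i * ν i ω) ^ 2} := by
    simp only [sq_le_sq, abs_of_pos hδ]
  rw [hset, ← ofReal_measureReal]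
  exact ENNReal.ofReal_le_ofReal hmarkov

theorem isOrthogonalNoise_of_pairwise_indepFun (hL2 : ∀ i, MemLp (ν i) 2 P)
    (hind : Pairwise fun i j => IndepFun (ν i) (ν j) P)
    (hmean : ∀ i, ∫ ω, ν i ω ∂P = 0) (hsq : ∀ i, ∫ ω, ν i ω * ν i ω ∂P = v) :
    IsOrthogonalNoise ν v P where
  integrable_mul i j := (hL2 i).integrable_mul (hL2 j)
  integral_mul_self := hsq
  integral_mul_eq_zero i j hij := by
    rw [(hind hij).integral_fun_mul_eq_mul_integral (hL2 i).1 (hL2 j).1, hmean, zero_mul]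

theorem isOrthogonalNoise_of_gaussian {v : ℝ≥0} (hνm : ∀ i, Measurable (ν i))
    (hind : Pairwise fun i j => IndepFun (ν i) (ν j) P)
    (hlaw : ∀ i, P.map (ν i) = gaussianReal 0 v) :
    IsOrthogonalNoise ν v P := by
  have hmean : ∀ i, ∫ ω, ν i ω ∂P = 0 := fun i => by
    have h := integral_id_gaussianReal (μ := 0) (v := v)
    rwa [← hlaw i, integral_map (hνm i).aemeasurable (by fun_prop)] at h
  refine isOrthogonalNoise_of_pairwise_indepFun (fun i => ?_) hind hmean fun i => ?_
  · have h := memLp_id_gaussianReal' (μ := 0) (v := v) 2 ENNReal.ofNat_ne_top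
    rw [← hlaw i] at h
    exact h.comp_of_map (hνm i).aemeasurable
  · have h := variance_id_gaussianReal (μ := 0) (v := v)
    rw [← hlaw i, variance_map (by fun_prop) (hνm i).aemeasurable, Function.id_comp,
      variance_of_integral_eq_zero (hνm i).aemeasurable (hmean i)] at h
    simpa only [pow_two] using h

end Noise

section Conditioning

variable {Ω β : Type*} {m : MeasurableSpace Ω} [mΩ : MeasurableSpace Ω] [StandardBorelSpace Ω]
  {μ : Measure Ω} [IsFiniteMeasure μ]

theorem ae_ae_condExpKernel_eq [MeasurableSpace β] [MeasurableEq β] (hm : m ≤ mΩ) {g : Ω → β}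
    (hg : Measurable[m] g) : ∀ᵐ ω ∂μ, ∀ᵐ ω' ∂condExpKernel μ m ω, g ω = g ω' := by
  have hdiag : @AEMeasurable Ω (Ω × Ω) (m.prod mΩ) mΩ Function.diag μ :=
    @Measurable.aemeasurable Ω (Ω × Ω) mΩ (m.prod mΩ) _ μ
      ((measurable_id'' hm).prodMk measurable_id)
  have hset : MeasurableSet[m.prod mΩ] {q : Ω × Ω | g q.1 = g q.2} :=
    measurableSet_eq_fun (m := m.prod mΩ) (hg.comp (@measurable_fst _ _ m mΩ))
      ((hg.mono hm le_rfl).comp (@measurable_snd _ _ m mΩ))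
  have hpair : ∀ᵐ q ∂(μ.trim hm) ⊗ₘ condExpKernel μ m, g q.1 = g q.2 := by
    rw [compProd_trim_condExpKernel, ae_map_iff hdiag hset]
    exact ae_of_all μ fun _ => rfl
  exact ae_of_ae_trim hm (Measure.ae_ae_of_ae_compProd hpair)

-- Freezing: given the history, the data it determines may be treated as constants.
theorem ae_condExpKernel_freeze [MeasurableSpace β] [MeasurableEq β] (hm : m ≤ mΩ) {g : Ω → β}
    (hg : Measurable[m] g) : ∀ᵐ ω ∂μ, ∀ s : β → Set Ω,
      condExpKernel μ m ω {ω' | ω' ∈ s (g ω')} = condExpKernel μ m ω (s (g ω)) := by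
  filter_upwards [ae_ae_condExpKernel_eq hm hg] with ω hω s
  refine measure_congr (hω.mono fun ω' hω' => ?_)
  change (ω' ∈ s (g ω')) = (ω' ∈ s (g ω))
  rw [hω']

theorem IsOrthogonalNoise.ae_condExpKernel {ι : Type*} [Countable ι] {ν : ι → Ω → ℝ} {v : ℝ}
    (hν : IsOrthogonalNoise ν v μ) (hm : m ≤ mΩ) (hνm : ∀ i, Measurable (ν i))
    (hindep : Indep (MeasurableSpace.comap (fun ω i => ν i ω) MeasurableSpace.pi) m μ) :
    ∀ᵐ ω ∂μ, IsOrthogonalNoise ν v (condExpKernel μ m ω) := by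
  have hmoment : ∀ i j, ∀ᵐ ω ∂μ,
      Integrable (fun ω' => ν i ω' * ν j ω') (condExpKernel μ m ω) ∧
        ∫ ω', ν i ω' * ν j ω' ∂condExpKernel μ m ω =
          ∫ ω', ν i ω' * ν j ω' ∂μ := fun i j => by
    have hprod : StronglyMeasurable[MeasurableSpace.comap (fun ω i => ν i ω) MeasurableSpace.pi]
        (fun ω => ν i ω * ν j ω) :=
      (Measurable.mul ((measurable_pi_apply i).comp (comap_measurable fun ω i => ν i ω))
        ((measurable_pi_apply j).comp (comap_measurable fun ω i => ν i ω))).stronglyMeasurable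
    filter_upwards [(hν.integrable_mul i j).condExpKernel_ae (m := m),
      condExp_ae_eq_integral_condExpKernel hm (hν.integrable_mul i j),
      condExp_indep_eq (measurable_pi_lambda _ hνm).comap_le hm hprod hindep]
      with ω hint hkernel hcond
    exact ⟨hint, by rw [← hkernel, hcond]⟩
  filter_upwards [ae_all_iff.2 fun i => ae_all_iff.2 (hmoment i)] with ω hω
  exact ⟨fun i j => (hω i j).1, fun i => (hω i i).2.trans (hν.integral_mul_self i),
    fun i j hij => (hω i j).2.trans (hν.integral_mul_eq_zero i j hij)⟩

end Conditioning

section Probability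

variable {Ω : Type*} [MeasurableSpace Ω] {P : Measure Ω}

theorem eventually_le_measure_of_subset_union {ι : Type*} {l : Filter ι} {A B C : ι → Set Ω}
    {a b : ℝ≥0∞} (hab : a < b) (hA : ∀ᶠ i in l, b ≤ P (A i)) (hsub : ∀ i, A i ⊆ B i ∪ C i)
    (hC : Tendsto (fun i => P (C i)) l (𝓝 0)) : ∀ᶠ i in l, a ≤ P (B i) := by
  filter_upwards [hA, hC.eventually_lt_const (tsub_pos_of_lt hab)] with i hAi hCi
  by_contra! hBi
  have hlt : P (B i) + P (C i) < b :=
    (ENNReal.add_lt_add hBi hCi).trans_eq (add_tsub_cancel_of_le hab.le)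
  exact (hAi.trans ((measure_mono (hsub i)).trans (measure_union_le _ _))).not_gt hlt

variable [IsFiniteMeasure P] {v : ℝ} {ν : ℕ → Ω → ℝ} {σ : ℝ}

theorem tendstoInMeasure_sampledMean {X H : Type*} [TopologicalSpace X] [NormedAddCommGroup H]
    [InnerProductSpace ℝ H] [CompleteSpace H] [RKHS ℝ H X ℝ]
    (hc : Continuous fun q : X × X => scalarKernel H q.1 q.2) (hσ : σ ≠ 0) (f : H) (L : ℕ)
    (ξ : ℕ → X) (z : ℕ → ℝ) {y : ℕ → X} {u : X} (hu : MapClusterPt u atTop y)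
    (hν : IsOrthogonalNoise ν v P) :
    TendstoInMeasure P (fun n ω =>
      sampledMean (scalarKernel H) σ f L ξ z y (fun i => ν i ω) n u) atTop fun _ => f u := by
  obtain ⟨b, w, hb, hw, hsplit⟩ := exists_tendsto_sub_sampledMean_eq hc hσ f L ξ z hu
  refine tendstoInMeasure_iff_dist.2 fun ε hε => ?_
  have hchebyshev : Tendsto (fun n => ENNReal.ofReal (v * (∑ i, w n i ^ 2) / (ε / 2) ^ 2)) atTop
      (𝓝 0) := by
    simpa only [mul_zero, zero_div, ENNReal.ofReal_zero] using
      ENNReal.tendsto_ofReal ((hw.const_mul v).div_const ((ε / 2) ^ 2))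
  refine tendsto_of_tendsto_of_tendsto_of_le_of_le' tendsto_const_nhds hchebyshev
    (.of_forall fun _ => zero_le) ?_
  have hbε : ∀ᶠ n in atTop, |b n| < ε / 2 := by
    simpa only [Real.dist_0_eq_abs] using Metric.tendsto_nhds.1 hb (ε / 2) (half_pos hε)
  filter_upwards [hbε] with n hn
  refine (measure_mono fun ω hω => ?_).trans
    ((hν.comp_injective Fin.val_injective).measure_le_abs_sum_le (w n) (half_pos hε))
  have hdist : ε ≤ |b n - ∑ i, w n i * ν i ω| := by
    rwa [← hsplit n fun i => ν i ω, ← Real.dist_eq, dist_comm]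
  have htri := hdist.trans (abs_sub (b n) (∑ i, w n i * ν i ω))
  exact (by linarith : ε / 2 ≤ |∑ i, w n i * ν i ω|)

theorem eventually_le_measure_isFullyLinear {d : ℕ} {H : Type*} [NormedAddCommGroup H]
    [InnerProductSpace ℝ H] [CompleteSpace H] [RKHS ℝ H (EuclideanSpace ℝ (Fin d)) ℝ]
    (hc : Continuous fun q : EuclideanSpace ℝ (Fin d) × EuclideanSpace ℝ (Fin d) =>
      scalarKernel H q.1 q.2)
    (f : H) {Lg κν γ : ℝ≥0} (hf : IsLC1 Lg (f : EuclideanSpace ℝ (Fin d) → ℝ))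
    {κef κeg : ℝ} (hκef : 0 < κef) (hκeg : 0 < κeg) (hκν : Lg + γ ≤ κν) {α p : ℝ≥0∞} (hp : α < p)
    {x : EuclideanSpace ℝ (Fin d)} {Δ : ℝ} (hΔ : 0 < Δ) (L : ℕ)
    (ξ : ℕ → EuclideanSpace ℝ (Fin d)) (z : ℕ → ℝ) {y : ℕ → EuclideanSpace ℝ (Fin d)}
    (hy : FillsBall y x Δ) (hσ : σ ≠ 0) (hν : IsOrthogonalNoise ν v P)
    (hmis : ∀ᶠ n in atTop, p ≤ P {ω | IsLC1 γ (⇑f -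
      sampledMean (scalarKernel H) σ f L ξ z y (fun i => ν i ω) n)}) :
    ∀ᶠ n in atTop, α ≤ P {ω | IsFullyLinear κef κeg κν f
      (sampledMean (scalarKernel H) σ f L ξ z y (fun i => ν i ω) n) x Δ} := by
  obtain ⟨S, hS, ε, hε, hlinear⟩ := exists_finset_isFullyLinear hf hκν hκef hκeg x hΔ
  set mean : ℕ → Ω → EuclideanSpace ℝ (Fin d) → ℝ := fun n ω =>
    sampledMean (scalarKernel H) σ f L ξ z y (fun i => ν i ω) n
  have hfar : Tendsto (fun n => P (⋃ u ∈ S, {ω | ε ≤ dist (mean n ω u) (f u)})) atTop (𝓝 0) := by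
    have hpoint : ∀ u ∈ S, Tendsto (fun n => P {ω | ε ≤ dist (mean n ω u) (f u)}) atTop (𝓝 0) :=
      fun u hu => tendstoInMeasure_iff_dist.1 (tendstoInMeasure_sampledMean hc hσ f L ξ z
        (hy.mapClusterPt (hS hu)) hν) ε hε
    have hsum := tendsto_finsetSum S hpoint
    rw [Finset.sum_const_zero] at hsum
    exact tendsto_of_tendsto_of_tendsto_of_le_of_le tendsto_const_nhds hsum
      (fun _ => zero_le) fun _ => measure_biUnion_finset_le S _
  refine eventually_le_measure_of_subset_union hp hmis (fun n ω hω => ?_) hfar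
  refine or_iff_not_imp_right.2 fun hnear => hlinear _ hω fun u hu => ?_
  by_contra! hlt
  rw [← Real.dist_eq, dist_comm] at hlt
  exact hnear (mem_iUnion₂.2 ⟨u, hu, hlt.le⟩)

theorem gradientConst_pos_of_ae_le {d : ℕ} {Ω' : Type*} [MeasurableSpace Ω'] {μ : Measure Ω}
    [NeZero μ] {Q : Ω → Measure Ω'} {f : EuclideanSpace ℝ (Fin d) → ℝ}
    {m : ℕ → Ω' → EuclideanSpace ℝ (Fin d) → ℝ} {x : Ω' → EuclideanSpace ℝ (Fin d)} {Δ : Ω → ℝ}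
    {γ : ℝ≥0} {κef κeg κbh : ℝ} {p : ℝ≥0∞} (hκef : 0 ≤ κef) (hp : 0 < p)
    (hmis : ∀ᵐ ω ∂μ, ∀ᶠ n in atTop, p ≤ Q ω {ω' | IsRegularMismatch γ κbh f (m n ω') (x ω')})
    (hΔ : ∀ᵐ ω ∂μ, 0 < Δ ω ∧ Δ ω < 6 / γ * (κeg - 2 * κef - κbh)) : 0 < κeg := by
  obtain ⟨ω, hmisω, hΔω⟩ := (hmis.and hΔ).exists
  obtain ⟨n, hn⟩ := hmisω.exists
  obtain ⟨ω', hω'⟩ := nonempty_of_measure_ne_zero (hp.trans_le hn).ne'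
  exact hω'.gradientConst_pos hκef hΔω.1 hΔω.2

end Probability

end GPTrust

open GPTrust in
theorem theorem2_general {d : ℕ}
    {H : Type*} [NormedAddCommGroup H] [InnerProductSpace ℝ H] [CompleteSpace H]
    [RKHS ℝ H (EuclideanSpace ℝ (Fin d)) ℝ]
    (hc : Continuous fun q : EuclideanSpace ℝ (Fin d) × EuclideanSpace ℝ (Fin d) =>
      scalarKernel H q.1 q.2)
    (f : H) {Lg κν γ : ℝ≥0} (hf : IsLC1 Lg (f : EuclideanSpace ℝ (Fin d) → ℝ))
    {κef κeg : ℝ} (hκef : 0 < κef) (hκeg : 0 < κeg) (hκν : Lg + γ ≤ κν) {α p : ℝ≥0∞} (hp : α < p)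
    {Ω : Type*} {𝓖 : MeasurableSpace Ω} [mΩ : MeasurableSpace Ω] [StandardBorelSpace Ω]
    {μ : Measure Ω} [IsFiniteMeasure μ] (h𝓖 : 𝓖 ≤ mΩ)
    {x : Ω → EuclideanSpace ℝ (Fin d)} (hx : Measurable[𝓖] x)
    {Δ : Ω → ℝ} (hΔm : Measurable[𝓖] Δ)
    {L : Ω → ℕ} (hL : Measurable[𝓖] L)
    {ξ : ℕ → Ω → EuclideanSpace ℝ (Fin d)} (hξ : ∀ j, Measurable[𝓖] (ξ j))
    {z : ℕ → Ω → ℝ} (hz : ∀ j, Measurable[𝓖] (z j))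
    {y : ℕ → Ω → EuclideanSpace ℝ (Fin d)} (hy : ∀ i, Measurable[𝓖] (y i))
    (hfill : ∀ᵐ ω ∂μ, FillsBall (fun i => y i ω) (x ω) (Δ ω))
    {σ v : ℝ} (hσ : σ ≠ 0)
    {ν : ℕ → Ω → ℝ} (hνm : ∀ i, Measurable[mΩ] (ν i)) (hν : IsOrthogonalNoise ν v μ)
    (hν𝓖 : Indep (MeasurableSpace.comap (fun ω i => ν i ω) MeasurableSpace.pi) 𝓖 μ)
    (hmis : ∀ᵐ ω ∂μ, ∀ᶠ n in atTop, p ≤ condExpKernel μ 𝓖 ω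
      {ω' | IsLC1 γ (⇑f - sampledMean (scalarKernel H) σ f (L ω') (fun j => ξ j ω')
        (fun j => z j ω') (fun i => y i ω') (fun i => ν i ω') n)})
    (hΔ : ∀ᵐ ω ∂μ, 0 < Δ ω) :
    ∀ᵐ ω ∂μ, ∃ N : ℕ, 0 < N ∧ ∀ n ≥ N, α ≤ condExpKernel μ 𝓖 ω
      {ω' | IsFullyLinear κef κeg κν f
        (sampledMean (scalarKernel H) σ f (L ω') (fun j => ξ j ω') (fun j => z j ω')
          (fun i => y i ω') (fun i => ν i ω') n) (x ω') (Δ ω')} := by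
  have hhistory : Measurable[𝓖] fun ω =>
      ((x ω, Δ ω, L ω), fun j => (ξ j ω, z j ω, y j ω)) :=
    (hx.prodMk (hΔm.prodMk hL)).prodMk
      (@measurable_pi_lambda _ _ _ 𝓖 _ _ fun j => (hξ j).prodMk ((hz j).prodMk (hy j)))
  -- Instance search does not find this one inside the space of sequences.
  have : StandardBorelSpace (EuclideanSpace ℝ (Fin d) × ℝ × EuclideanSpace ℝ (Fin d)) :=
    inferInstance
  filter_upwards [ae_condExpKernel_freeze (μ := μ) h𝓖 hhistory, hν.ae_condExpKernel h𝓖 hνm hν𝓖,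
    hfill, hmis, hΔ] with ω hfreeze hνω hfillω hmisω hΔω
  have hmisω' := hmisω.mono fun n hn => hn.trans_eq (hfreeze fun ((_, _, L), s) =>
    {ω' | IsLC1 γ (⇑f - sampledMean (scalarKernel H) σ f L (fun j => (s j).1)
      (fun j => (s j).2.1) (fun j => (s j).2.2) (fun i => ν i ω') n)})
  obtain ⟨N, hN⟩ := eventually_atTop.1 (eventually_le_measure_isFullyLinear hc f hf hκef hκeg hκν
    hp hΔω (L ω) (fun j => ξ j ω) (fun j => z j ω) hfillω hσ hνω hmisω')
  refine ⟨N + 1, N.succ_pos, fun n hn => (hN n (by omega)).trans_eq ?_⟩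
  exact (hfreeze fun ((x, Δ, L), s) => {ω' | IsFullyLinear κef κeg κν f
    (sampledMean (scalarKernel H) σ f L (fun j => (s j).1) (fun j => (s j).2.1)
      (fun j => (s j).2.2) (fun i => ν i ω') n) x Δ}).symm

open GPTrust in
/-- One iteration of the trust-region method: the sigma-algebra `𝓖` is the history before the
iteration; the current iterate `x`, the radius `Δ`, the data set collected so far (`L` points
`ξ j` with values `z j`) and the new sampling sites `y i` are determined by the history, and the
noise `ν i` of the new evaluations is independent of it. Probabilities given the history are
regular conditional probabilities. -/
theorem theorem2 {d : ℕ}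
    -- the reproducing kernel Hilbert space, its kernel, and the unknown function
    {H : Type*} [NormedAddCommGroup H] [InnerProductSpace ℝ H] [CompleteSpace H]
    [RKHS ℝ H (EuclideanSpace ℝ (Fin d)) ℝ]
    (hc : Continuous fun q : EuclideanSpace ℝ (Fin d) × EuclideanSpace ℝ (Fin d) =>
      scalarKernel H q.1 q.2)
    (f : H) (ζ : ℝ) (hζ : ‖f‖ ≤ ζ) (Lg : ℝ≥0) (hf : IsLC1 Lg (f : EuclideanSpace ℝ (Fin d) → ℝ))
    -- the constants
    (κef κeg κbhh : ℝ) (κν γ : ℝ≥0) (hκef : 0 < κef) (hγ : 0 < γ) (hκν : Lg + γ ≤ κν)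
    (α p : ℝ) (hα : α ∈ Ioo (0 : ℝ) 1) (hp : α < p)
    -- the probability space and the history
    {Ω : Type*} (𝓖 : MeasurableSpace Ω) [mΩ : MeasurableSpace Ω] [StandardBorelSpace Ω]
    (μ : Measure Ω) [IsProbabilityMeasure μ] (h𝓖 : 𝓖 ≤ mΩ)
    (x : Ω → EuclideanSpace ℝ (Fin d)) (hx : Measurable[𝓖] x)
    (Δ : Ω → ℝ) (hΔm : Measurable[𝓖] Δ)
    (L : Ω → ℕ) (hL : Measurable[𝓖] L)
    (ξ : ℕ → Ω → EuclideanSpace ℝ (Fin d)) (hξ : ∀ j, Measurable[𝓖] (ξ j))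
    (z : ℕ → Ω → ℝ) (hz : ∀ j, Measurable[𝓖] (z j))
    -- the new samples
    (y : ℕ → Ω → EuclideanSpace ℝ (Fin d)) (hy : ∀ i, Measurable[𝓖] (y i))
    (hfill : ∀ᵐ ω ∂μ, FillsBall (fun i => y i ω) (x ω) (Δ ω))
    (σ : ℝ≥0) (hσ : 0 < σ)
    (ν : ℕ → Ω → ℝ) (hνm : ∀ i, Measurable[mΩ] (ν i)) (hνind : iIndepFun ν μ)
    (hνlaw : ∀ i, μ.map (ν i) = gaussianReal 0 (σ ^ 2))
    (hν𝓖 : Indep (MeasurableSpace.comap (fun ω i => ν i ω) MeasurableSpace.pi) 𝓖 μ)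
    -- given the history, the mismatch is regular with probability at least `p` (almost surely if
    -- `p = 1`; as Gaussian noise is unbounded, a smaller `p` is the case of interest)
    (hmis : ∀ᵐ ω ∂μ, ∀ᶠ n in atTop, ENNReal.ofReal p ≤ condExpKernel μ 𝓖 ω
      {ω' | IsRegularMismatch γ κbhh f
        (sampledMean (scalarKernel H) σ f (L ω') (fun j => ξ j ω') (fun j => z j ω')
          (fun i => y i ω') (fun i => ν i ω') n) (x ω')})
    -- the condition on the radius
    (hΔ : ∀ᵐ ω ∂μ, 0 < Δ ω ∧ Δ ω < 6 / γ * (κeg - 2 * κef - κbhh)) :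
    ∀ᵐ ω ∂μ, ∃ N : ℕ, 0 < N ∧ ∀ n ≥ N, ENNReal.ofReal α ≤ condExpKernel μ 𝓖 ω
      {ω' | IsFullyLinear κef κeg κν f
        (sampledMean (scalarKernel H) σ f (L ω') (fun j => ξ j ω') (fun j => z j ω')
          (fun i => y i ω') (fun i => ν i ω') n) (x ω') (Δ ω')} := by
  have hp0 : 0 < ENNReal.ofReal p := ENNReal.ofReal_pos.2 (hα.1.trans hp)
  have hαp : ENNReal.ofReal α < ENNReal.ofReal p :=
    (ENNReal.ofReal_lt_ofReal_iff (hα.1.trans hp)).2 hp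
  have hν : IsOrthogonalNoise ν (σ ^ 2 : ℝ≥0) μ :=
    isOrthogonalNoise_of_gaussian hνm (fun _ _ => hνind.indepFun) hνlaw
  exact theorem2_general hc f hf hκef (gradientConst_pos_of_ae_le hκef.le hp0 hmis hΔ) hκν hαp
    h𝓖 hx hΔm hL hξ hz hy hfill (NNReal.coe_ne_zero.2 hσ.ne') hνm hν hν𝓖
    (hmis.mono fun _ h => h.mono fun _ hp => hp.trans (measure_mono fun _ => And.left))
    (hΔ.mono fun _ => And.left)
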